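/- Let $K_n$ be the complete graph on $n$ vertices. For integers $r\ge 1$, $\ell\ge 1$ and a finite graph $G$ with at least two vertices, let $\kappa_{r,\ell}(G)$ (the alternating connectivity of $G$) be the maximum $t$ such that there is a (not necessarily proper) coloring of the edges of $G$ with $r$ colors for which any two distinct vertices of $G$ are connected by $t$ pairwise internally disjoint alternating paths of length $\ell$. Here the length of a path is its number of edges, a path is alternating if any two of its adjacent edges have different colors, and two paths with the same end vertices are internally disjoint if they have no other vertex in common. Then for every fixed integer $r\ge 2$, as $n\to\infty$, $$\kappa_{r,2}(K_n)\sim\Bigl(1-\frac1r\Bigr)n,$$ and for every fixed integer $\ell\ge 3$, as $n\to\infty$, $$\kappa_{r,\ell}(K_n)\sim\frac{n}{\ell-1},$$ where $a_n\sim b_n$ means $\lim_{n\to\infty}a_n/b_n=1$. -/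

import Mathlib

namespace AltConn

open SimpleGraph

variable {V K : Type*} {G : SimpleGraph V}

/-- The sequence of colors of the edges traversed by a walk, in order. -/
def colors (c : G.EdgeLabeling K) : {u v : V} → G.Walk u v → List K
  | _, _, .nil => []
  | _, _, .cons h p => c.get _ _ h :: colors c p

/-- A walk is alternating if any two consecutive edges have different colors. -/
def IsAlternating (c : G.EdgeLabeling K) {u v : V} (p : G.Walk u v) : Prop :=
  (colors c p).IsChain (· ≠ ·)

/-- Two paths with the same ends are internally disjoint if they share no vertex except the ends. -/
def InternallyDisjoint {u v : V} (p q : G.Path u v) : Prop :=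
  ∀ w, w ∈ p.1.support → w ∈ q.1.support → w = u ∨ w = v

/-- Under the edge coloring `c`, the vertices `u` and `v` are connected by `t` (distinct) pairwise
internally disjoint alternating paths of length `l`. -/
def ConnectedBy (c : G.EdgeLabeling K) (l t : ℕ) (u v : V) : Prop :=
  ∃ P : Finset (G.Path u v), P.card = t ∧
    (∀ p ∈ P, p.1.length = l ∧ IsAlternating c p.1) ∧
    ∀ p ∈ P, ∀ q ∈ P, p ≠ q → InternallyDisjoint p q

/-- The numbers `t` for which some (not necessarily proper) `r`-edge-coloring of `G` connects every
pair of distinct vertices by `t` internally disjoint alternating paths of length `l`. -/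
def achievable (r l : ℕ) (G : SimpleGraph V) : Set ℕ :=
  {t | ∃ c : G.EdgeLabeling (Fin r), ∀ u v : V, u ≠ v → ConnectedBy c l t u v}

/-- The alternating connectivity of `G` for `r` colors and paths of length `l`. -/
noncomputable def alternatingConnectivity (r l : ℕ) (G : SimpleGraph V) : ℕ :=
  sSup (achievable r l G)

/-- The supremum is a maximum for every finite graph with at least two vertices, `r ≥ 1`. -/
theorem isGreatest_alternatingConnectivity [Finite V] [Nontrivial V] {r : ℕ} (hr : 1 ≤ r) (l : ℕ)
    (G : SimpleGraph V) : IsGreatest (achievable r l G) (alternatingConnectivity r l G) := by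
  classical
  have hne : (achievable r l G).Nonempty :=
    ⟨0, fun _ => ⟨0, hr⟩, fun u v _ => ⟨∅, by simp, by simp, by simp⟩⟩
  have hbdd : BddAbove (achievable r l G) := by
    cases nonempty_fintype V
    obtain ⟨u, v, huv⟩ := exists_pair_ne V
    refine ⟨Fintype.card (G.Path u v), ?_⟩
    rintro t ⟨c, hc⟩
    obtain ⟨P, rfl, -⟩ := hc u v huv
    exact P.card_le_univ
  exact ⟨Nat.sSup_mem hne hbdd, fun t ht => le_csSup hbdd ht⟩

end AltConn

/-! The upper bounds are counting. For `l ≥ 3` the interiors of the paths between one fixed pair are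
disjoint sets of `l - 1` vertices. For `l = 2` average over all pairs: at a middle vertex `w`,
Cauchy–Schwarz shows that at most a fraction `1 - 1/r` of the ordered pairs of edges has two colors.

The lower bounds come from a random coloring, in which by a Chernoff and union bound
(`eventually_exists_balanced_coloring`) every joint color class of every two vertices has size at
least about `n / r ^ 2`. Adding the `r ^ 2 - r` classes with two different colors settles `l = 2`.

For `l = k + 1 ≥ 3` two colors suffice. Balance makes the rows of the ±1 color matrix nearly
orthogonal, so both colors occur between any two sets of linear size (`exists_edge_of_balanced`).
For each color `a`, cut the `a`-neighborhood of `u`, about `n / 2` vertices, into `k` layers, the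
last one chosen so that its edges to `v` have the color needed at the end. Greedy extraction of
alternating sequences through the layers uses up all but a small part of them and gives about `n /
(2 * k)` paths; the two values of `a` together give `n / k`. -/

namespace AltConn

open SimpleGraph

/-! ### Random colorings with balanced joint color classes -/

/-- A lower-tail Chernoff bound, in counting form: few functions take a given value `α` rarely. -/
theorem card_rare_value_le {W A : Type*} [Fintype W] [Fintype A] [DecidableEq W] [DecidableEq A]
    (α : A) {δ : ℝ} (hδ : 0 < δ) :
    ((Finset.univ.filter fun g : W → A =>
        ((Finset.univ.filter fun w => g w = α).card : ℝ)
          < (1 / (Fintype.card A : ℝ) - δ) * Fintype.card W).card : ℝ) ≤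
      (Fintype.card A : ℝ) ^ Fintype.card W * Real.exp (-(Fintype.card W * δ ^ 2 / 4)) := by
  set a : ℝ := (Fintype.card A : ℝ) with ha
  set m := Fintype.card W with hm
  have ha1 : 1 ≤ a := by
    rw [ha]; exact_mod_cast Fintype.card_pos_iff.2 ⟨α⟩
  have ha0 : 0 < a := by linarith
  -- This value minimizes the final exponent bound `t ^ 2 - t * δ`, giving `-δ ^ 2 / 4`.
  set t : ℝ := δ / 2 with ht
  have ht0 : 0 < t := by positivity
  have hexp : Real.exp (-t) ≤ 1 - t + t ^ 2 := by
    have h1 : Real.exp (-t) * (1 + t) ≤ 1 := by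
      calc Real.exp (-t) * (1 + t) ≤ Real.exp (-t) * Real.exp t := by
            gcongr; linarith [Real.add_one_le_exp t]
        _ = 1 := by rw [← Real.exp_add]; simp
    have h2 : (1 : ℝ) ≤ (1 - t + t ^ 2) * (1 + t) := by nlinarith [pow_pos ht0 3]
    exact le_of_mul_le_mul_right (h1.trans h2) (by linarith)
  have hsum : ∑ x : A, (if x = α then Real.exp (-t) else 1) = a - 1 + Real.exp (-t) := by
    have : ∀ x : A, (if x = α then Real.exp (-t) else 1)
        = 1 + if x = α then Real.exp (-t) - 1 else 0 := by
      intro x; split_ifs <;> ring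
    simp only [this, Finset.sum_add_distrib, Finset.sum_ite_eq', Finset.mem_univ, if_true]
    simp [ha]; ring
  have hbase : a - 1 + Real.exp (-t) ≤ a * Real.exp (-((t - t ^ 2) / a)) := by
    have h := Real.add_one_le_exp (-((t - t ^ 2) / a))
    have h3 : a * (-((t - t ^ 2) / a) + 1) ≤ a * Real.exp (-((t - t ^ 2) / a)) := by gcongr
    have h4 : a * (-((t - t ^ 2) / a) + 1) = a - (t - t ^ 2) := by field_simp; ring
    linarith
  have hprod : ∑ g : W → A, ∏ w, (if g w = α then Real.exp (-t) else 1)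
      = (a - 1 + Real.exp (-t)) ^ m := by
    have h := Finset.prod_univ_sum (fun _ : W => (Finset.univ : Finset A))
      (fun _ x => if x = α then Real.exp (-t) else (1 : ℝ))
    rw [Fintype.piFinset_univ] at h
    rw [← h, hsum, Finset.prod_const, Finset.card_univ]
  have hpw : ∀ g : W → A, ∏ w, (if g w = α then Real.exp (-t) else 1)
      = Real.exp (-t * (Finset.univ.filter fun w => g w = α).card) := by
    intro g
    rw [Finset.prod_ite]
    simp only [Finset.prod_const, one_pow, mul_one]
    rw [← Real.exp_nat_mul]; congr 1; ring
  -- Markov's inequality for the exponential moment: each rare `g` has weight at least `1`, and the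
  -- total weight factors over the coordinates.
  calc _ ≤ ∑ g : W → A, Real.exp (t * ((1 / a - δ) * m)) *
          ∏ w, (if g w = α then Real.exp (-t) else 1) := by
        rw [Finset.card_filter]
        push_cast
        refine Finset.sum_le_sum fun g _ => ?_
        rw [hpw, ← Real.exp_add]
        split_ifs with h
        · apply Real.one_le_exp
          nlinarith
        · positivity
    _ = Real.exp (t * ((1 / a - δ) * m)) * (a - 1 + Real.exp (-t)) ^ m := by
        rw [← Finset.mul_sum, hprod]
    _ ≤ Real.exp (t * ((1 / a - δ) * m)) * (a * Real.exp (-((t - t ^ 2) / a))) ^ m := by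
        gcongr
    _ = a ^ m * Real.exp (m * (t ^ 2 / a - t * δ)) := by
        rw [mul_pow, ← Real.exp_nat_mul, mul_left_comm, ← Real.exp_add]
        congr 2
        field_simp
        ring
    _ ≤ _ := by
        gcongr
        have h5 : t ^ 2 / a ≤ t ^ 2 := div_le_self (by positivity) ha1
        have h6 : t ^ 2 / a - t * δ ≤ -(δ ^ 2 / 4) := by
          rw [ht] at *; nlinarith
        have : (0 : ℝ) ≤ m := by positivity
        nlinarith

/-- Restriction along an injection preserves the proportion of functions with a given property. -/
theorem card_filter_comp_mul {I E K : Type*} [Fintype I] [Fintype E] [Fintype K]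
    [DecidableEq I] [DecidableEq E] (φ : I → E) (hφ : φ.Injective)
    (P : (I → K) → Prop) [DecidablePred P] :
    (Finset.univ.filter fun ω : E → K => P (ω ∘ φ)).card * Fintype.card K ^ Fintype.card I =
      (Finset.univ.filter P).card * Fintype.card K ^ Fintype.card E := by
  classical
  let e : I ⊕ ↥(Set.range φ)ᶜ ≃ E :=
    ((Equiv.ofInjective φ hφ).sumCongr (Equiv.refl _)).trans (Equiv.Set.sumCompl _)
  have he : ∀ i, e (Sum.inl i) = φ i := fun i => by simp [e]
  let F : (E → K) ≃ (I → K) × (↥(Set.range φ)ᶜ → K) :=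
    (e.symm.arrowCongr (Equiv.refl K)).trans (Equiv.sumArrowEquivProdArrow _ _ _)
  have hF : ∀ ω, (F ω).1 = ω ∘ φ := by
    intro ω; funext i
    simp [F, Equiv.sumArrowEquivProdArrow, Equiv.arrowCongr, he]
  have hcard : (Finset.univ.filter fun ω : E → K => P (ω ∘ φ)).card =
      (Finset.univ.filter P).card * Fintype.card K ^ Fintype.card ↥(Set.range φ)ᶜ := by
    rw [← Fintype.card_fun, ← Finset.card_univ (α := ↥(Set.range φ)ᶜ → K), ← Finset.card_product]
    refine Finset.card_equiv F fun ω => ?_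
    simp [hF]
  have hE : Fintype.card E = Fintype.card I + Fintype.card ↥(Set.range φ)ᶜ := by
    rw [← Fintype.card_congr e, Fintype.card_sum]
  rw [hcard, hE, pow_add]
  ring

/-- The vertices outside `u`, `v` joined to `u` in color `i` and to `v` in color `j`. -/
def commonNbrs {V K : Type*} [Fintype V] [DecidableEq V] [DecidableEq K] (C : Sym2 V → K)
    (u v : V) (i j : K) : Finset V :=
  Finset.univ.filter fun w => (w ≠ u ∧ w ≠ v) ∧ C s(u, w) = i ∧ C s(v, w) = j

/-- For fixed `u ≠ v` and colors `i`, `j`, few colorings have too small `commonNbrs`. -/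
theorem card_few_commonNbrs_le {V K : Type*} [Fintype V] [DecidableEq V] [Fintype K]
    [DecidableEq K] {u v : V} (huv : u ≠ v) (i j : K) {δ : ℝ} (hδ : 0 < δ) :
    ((Finset.univ.filter fun C : Sym2 V → K => ((commonNbrs C u v i j).card : ℝ) <
        (1 / (Fintype.card K : ℝ) ^ 2 - δ) * (Fintype.card V - 2 : ℕ)).card : ℝ) ≤
      (Fintype.card K : ℝ) ^ Fintype.card (Sym2 V) *
        Real.exp (-((Fintype.card V - 2 : ℕ) * δ ^ 2 / 4)) := by
  classical
  let W := {w : V // w ≠ u ∧ w ≠ v}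
  have hW : Fintype.card W = Fintype.card V - 2 := by
    rw [Fintype.card_subtype]
    have : (Finset.univ.filter fun w : V => w ≠ u ∧ w ≠ v) = Finset.univ \ {u, v} := by
      ext; simp
    rw [this, Finset.card_sdiff_of_subset (Finset.subset_univ _), Finset.card_pair huv,
      Finset.card_univ]
  -- The pairs joining `u` and `v` to `W` are all distinct, so their colors are independent and each
  -- `w` sees the color vector `α` with probability `1 / |K| ^ 2`.
  let φ : W × Bool → Sym2 V := fun p => s(if p.2 then u else v, p.1.1)
  have hφ : φ.Injective := by
    rintro ⟨⟨w, hw⟩, b⟩ ⟨⟨w', hw'⟩, b'⟩ h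
    simp only [φ, Sym2.eq_iff] at h
    cases b <;> cases b' <;> grind
  let α : Bool → K := fun b => if b then i else j
  let P : (W × Bool → K) → Prop := fun g =>
    ((Finset.univ.filter fun w => Function.curry g w = α).card : ℝ) <
      (1 / (Fintype.card (Bool → K) : ℝ) - δ) * Fintype.card W
  have hK : (Fintype.card (Bool → K) : ℝ) = (Fintype.card K : ℝ) ^ 2 := by simp
  have hP : ∀ C : Sym2 V → K, ((commonNbrs C u v i j).card : ℝ) <
        (1 / (Fintype.card K : ℝ) ^ 2 - δ) * (Fintype.card V - 2 : ℕ) ↔ P (C ∘ φ) := by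
    intro C
    have : (Finset.univ.filter fun w : W => Function.curry (C ∘ φ) w = α).card =
        (commonNbrs C u v i j).card := by
      refine Finset.card_bij (fun w _ => w.1) ?_ ?_ ?_
      · rintro ⟨w, hw⟩ h
        simp only [Finset.mem_filter, Finset.mem_univ, true_and] at h
        simp only [commonNbrs, Finset.mem_filter, Finset.mem_univ, true_and]
        refine ⟨hw, ?_, ?_⟩
        · simpa [φ, α, Function.curry] using congrFun h true
        · simpa [φ, α, Function.curry] using congrFun h false
      · intro a _ b _ h; exact Subtype.ext h
      · intro w h
        simp only [commonNbrs, Finset.mem_filter, Finset.mem_univ, true_and] at h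
        refine ⟨⟨w, h.1⟩, ?_, rfl⟩
        simp only [Finset.mem_filter, Finset.mem_univ, true_and]
        funext b
        cases b <;> simp [φ, α, Function.curry, h.2.1, h.2.2]
    simp only [P, this, hK, hW]
  have hcount := card_filter_comp_mul (K := K) φ hφ P
  have hg : (Finset.univ.filter P).card = (Finset.univ.filter fun g : W → Bool → K =>
        ((Finset.univ.filter fun w => g w = α).card : ℝ)
          < (1 / (Fintype.card (Bool → K) : ℝ) - δ) * Fintype.card W).card := by
    refine Finset.card_equiv (Equiv.curry W Bool K) fun g => ?_
    simp only [Finset.mem_filter, Finset.mem_univ, true_and]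
    rfl
  have hch := card_rare_value_le (W := W) α hδ
  rw [← hg] at hch
  simp only [hP]
  generalize (Finset.univ.filter P).card = N at hch hcount
  rw [hK, hW] at hch
  have hpos : (0 : ℝ) < (Fintype.card K : ℝ) ^ Fintype.card (W × Bool) := by
    have : 0 < Fintype.card K := Fintype.card_pos_iff.2 ⟨i⟩
    positivity
  have hIc : (Fintype.card K : ℝ) ^ Fintype.card (W × Bool) =
      ((Fintype.card K : ℝ) ^ 2) ^ (Fintype.card V - 2) := by
    rw [← pow_mul, Fintype.card_prod, hW, Fintype.card_bool, mul_comm]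
  rw [← hIc] at hch
  have hcount' := congrArg (Nat.cast : ℕ → ℝ) hcount
  push_cast at hcount'
  rw [← mul_le_mul_iff_left₀ hpos, hcount']
  calc _ ≤ _ := mul_le_mul_of_nonneg_right hch (by positivity)
    _ = _ := by ring

/-- For large `n` some coloring of the pairs of an `n`-set has all joint color classes of any two
vertices of nearly the average size. -/
theorem eventually_exists_balanced_coloring (r : ℕ) (hr : 1 ≤ r) {δ : ℝ} (hδ : 0 < δ) :
    ∀ᶠ n : ℕ in Filter.atTop, ∃ C : Sym2 (Fin n) → Fin r, ∀ u v, u ≠ v → ∀ i j,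
      (1 / (r : ℝ) ^ 2 - δ) * n ≤ (commonNbrs C u v i j).card := by
  have hlim : Filter.Tendsto (fun n : ℕ => (r : ℝ) ^ 2 * Real.exp (2 * (δ / 2) ^ 2 / 4) *
      ((n : ℝ) ^ 2 * Real.exp (-((δ / 2) ^ 2 / 4) * n))) Filter.atTop (nhds 0) := by
    have h := tendsto_pow_const_mul_const_pow_of_lt_one 2
      (Real.exp_pos (-((δ / 2) ^ 2 / 4))).le (Real.exp_lt_one_iff.2 (neg_neg_of_pos (by positivity)))
    simp only [← Real.exp_nat_mul] at h
    have h' := h.const_mul ((r : ℝ) ^ 2 * Real.exp (2 * (δ / 2) ^ 2 / 4))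
    rw [mul_zero] at h'
    refine h'.congr fun n => ?_
    rw [mul_comm (n : ℝ)]
  have hsmall := hlim.eventually (gt_mem_nhds (show (0 : ℝ) < 1 by norm_num))
  -- Replacing `n - 2` by `n` costs at most `2`, which the spare `δ / 2 * n` pays for.
  have hlarge : ∀ᶠ n : ℕ in Filter.atTop, 4 / δ ≤ n :=
    tendsto_natCast_atTop_atTop.eventually_ge_atTop _
  filter_upwards [hsmall, hlarge, Filter.eventually_ge_atTop 2] with n h1 h2 h3
  have hr0 : (0 : ℝ) < r := by exact_mod_cast hr
  have hr1 : 1 / (r : ℝ) ^ 2 ≤ 1 := by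
    rw [div_le_one (by positivity)]
    exact one_le_pow₀ (by exact_mod_cast hr)
  by_contra hcon
  push Not at hcon
  -- Union bound: without a good coloring these `n ^ 2 * r ^ 2` sets would cover all colorings,
  -- although each is an exponentially small part of them.
  let bad : (Fin n × Fin n) × (Fin r × Fin r) → Finset (Sym2 (Fin n) → Fin r) := fun q =>
    if q.1.1 = q.1.2 then ∅ else
    Finset.univ.filter fun C => ((commonNbrs C q.1.1 q.1.2 q.2.1 q.2.2).card : ℝ) <
        (1 / (Fintype.card (Fin r) : ℝ) ^ 2 - δ / 2) * (Fintype.card (Fin n) - 2 : ℕ)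
  have hcover : (Finset.univ : Finset (Sym2 (Fin n) → Fin r)) ⊆ Finset.univ.biUnion bad := by
    intro C _
    obtain ⟨u, v, huv, i, j, hC⟩ := hcon C
    refine Finset.mem_biUnion.2 ⟨((u, v), (i, j)), Finset.mem_univ _, ?_⟩
    simp only [bad, huv, if_false, Finset.mem_filter, Finset.mem_univ, true_and, Fintype.card_fin]
    refine hC.trans_le ?_
    rw [Nat.cast_sub h3]
    rw [div_le_iff₀ hδ] at h2
    push_cast
    nlinarith
  have hbad : ∀ q, ((bad q).card : ℝ) ≤ (r : ℝ) ^ Fintype.card (Sym2 (Fin n)) *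
        Real.exp (-((n - 2 : ℕ) * (δ / 2) ^ 2 / 4)) := by
    rintro ⟨⟨u, v⟩, i, j⟩
    by_cases huv : u = v
    · simp only [bad, huv, if_true, Finset.card_empty, Nat.cast_zero]
      positivity
    · have := card_few_commonNbrs_le huv i j (half_pos hδ)
      simpa only [bad, huv, if_false, Fintype.card_fin] using this
  have hle := (Finset.card_le_card hcover).trans Finset.card_biUnion_le
  have hle' : ((r : ℝ) ^ Fintype.card (Sym2 (Fin n))) ≤
      ∑ q, ((bad q).card : ℝ) := by
    rw [Finset.card_univ, Fintype.card_fun, Fintype.card_fin] at hle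
    exact_mod_cast hle
  have hub := hle'.trans (Finset.sum_le_sum fun q _ => hbad q)
  rw [Finset.sum_const, Finset.card_univ, nsmul_eq_mul] at hub
  simp only [Fintype.card_prod, Fintype.card_fin] at hub
  have hR : (0 : ℝ) < (r : ℝ) ^ Fintype.card (Sym2 (Fin n)) := by positivity
  have hexp : Real.exp (-((n - 2 : ℕ) * (δ / 2) ^ 2 / 4)) =
      Real.exp (2 * (δ / 2) ^ 2 / 4) * Real.exp (-((δ / 2) ^ 2 / 4) * n) := by
    rw [← Real.exp_add, Nat.cast_sub h3]
    congr 1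
    push_cast
    ring
  rw [hexp] at hub
  push_cast at hub
  nlinarith

/-! ### Paths from vertex sequences -/

/-- The walk through the values of a sequence. -/
def seqWalk {V : Type*} {G : SimpleGraph V} (f : ℕ → V) :
    (k : ℕ) → (∀ i < k, G.Adj (f i) (f (i + 1))) → G.Walk (f 0) (f k)
  | 0, _ => .nil
  | k + 1, h => .cons (h 0 k.succ_pos)
      (seqWalk (fun i => f (i + 1)) k fun i hi => h (i + 1) (Nat.succ_lt_succ hi))

theorem length_seqWalk {V : Type*} {G : SimpleGraph V} (f : ℕ → V) (k : ℕ)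
    (h : ∀ i < k, G.Adj (f i) (f (i + 1))) : (seqWalk f k h).length = k := by
  induction k generalizing f with
  | zero => rfl
  | succ k ih => simp [seqWalk, ih]

theorem support_seqWalk {V : Type*} {G : SimpleGraph V} (f : ℕ → V) (k : ℕ)
    (h : ∀ i < k, G.Adj (f i) (f (i + 1))) :
    (seqWalk f k h).support = (List.range (k + 1)).map f := by
  induction k generalizing f with
  | zero => rfl
  | succ k ih =>
    rw [seqWalk, Walk.support_cons, ih, List.range_succ_eq_map (n := k + 1), List.map_cons,
      List.map_map]
    rfl

/-- The edge labeling of a graph induced by a labeling of all pairs of vertices. -/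
def labelingOfSym2 {V K : Type*} (G : SimpleGraph V) (C : Sym2 V → K) : G.EdgeLabeling K :=
  fun e => C e.1

theorem colors_seqWalk {V K : Type*} {G : SimpleGraph V} (C : Sym2 V → K) (f : ℕ → V) (k : ℕ)
    (h : ∀ i < k, G.Adj (f i) (f (i + 1))) :
    colors (labelingOfSym2 G C) (seqWalk f k h) =
      (List.range k).map fun i => C s(f i, f (i + 1)) := by
  induction k generalizing f with
  | zero => rfl
  | succ k ih =>
    rw [seqWalk, colors, ih, List.range_succ_eq_map (n := k), List.map_cons, List.map_map]
    rfl

/-- A family of vertex sequences from `u` to `v`, disjoint in the interior and with alternating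
colors, witnesses `ConnectedBy`. -/
theorem connectedBy_of_sequences {V K ι : Type*} [Fintype ι] {C : Sym2 V → K} {l : ℕ}
    (hl : 2 ≤ l) {u v : V} (f : ι → ℕ → V) (hu : ∀ j, f j 0 = u) (hv : ∀ j, f j l = v)
    (hinj : ∀ j, Set.InjOn (f j) (Set.Iic l))
    (hdisj : ∀ j j' i i', 0 < i → i < l → i' ≤ l → f j i = f j' i' → j = j')
    (halt : ∀ j i, i + 2 ≤ l → C s(f j i, f j (i + 1)) ≠ C s(f j (i + 1), f j (i + 2))) :
    ConnectedBy (labelingOfSym2 ⊤ C) l (Fintype.card ι) u v := by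
  classical
  have key : ∀ j, ∃ p : (⊤ : SimpleGraph V).Path u v,
      p.1.support = (List.range (l + 1)).map (f j) ∧ p.1.length = l ∧
        IsAlternating (labelingOfSym2 ⊤ C) p.1 := by
    intro j
    obtain rfl := hu j
    obtain rfl := hv j
    have hadj : ∀ i < l, (⊤ : SimpleGraph V).Adj (f j i) (f j (i + 1)) := by
      intro i hi h
      have := hinj j (Set.mem_Iic.2 hi.le) (Set.mem_Iic.2 hi) h
      omega
    refine ⟨⟨seqWalk (f j) l hadj, ?_⟩, support_seqWalk _ _ _, length_seqWalk _ _ _, ?_⟩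
    · rw [Walk.isPath_def, support_seqWalk]
      refine List.Nodup.map_on ?_ List.nodup_range
      intro x hx y hy hxy
      simp only [List.mem_range] at hx hy
      exact hinj j (Set.mem_Iic.2 (by omega)) (Set.mem_Iic.2 (by omega)) hxy
    · rw [IsAlternating, colors_seqWalk, List.isChain_iff_getElem]
      intro i hi
      simp only [List.length_map, List.length_range] at hi
      simpa using halt j i (by omega)
  choose p hsupp hlen hpalt using key
  have hmem : ∀ j w, w ∈ (p j).1.support ↔ ∃ i ≤ l, f j i = w := by
    intro j w
    simp [hsupp]
  have hp : Function.Injective p := by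
    intro j j' h
    -- Position `1` is interior because `2 ≤ l`, so it determines the sequence.
    have h1 : f j 1 ∈ (p j').1.support := by rw [← h, hmem]; exact ⟨1, by omega, rfl⟩
    obtain ⟨i, hi, h2⟩ := (hmem _ _).1 h1
    exact hdisj j j' 1 i one_pos (by omega) hi h2.symm
  refine ⟨Finset.univ.image p, ?_, ?_, ?_⟩
  · rw [Finset.card_image_of_injective _ hp, Finset.card_univ]
  · intro q hq
    obtain ⟨j, -, rfl⟩ := Finset.mem_image.1 hq
    exact ⟨hlen j, hpalt j⟩
  · intro q hq q' hq' hne w hw hw'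
    obtain ⟨j, -, rfl⟩ := Finset.mem_image.1 hq
    obtain ⟨j', -, rfl⟩ := Finset.mem_image.1 hq'
    obtain ⟨i, hi, rfl⟩ := (hmem _ _).1 hw
    obtain ⟨i', hi', h⟩ := (hmem _ _).1 hw'
    rcases Nat.eq_zero_or_pos i with rfl | hi0
    · exact .inl (hu j)
    rcases hi.lt_or_eq with hil | rfl
    · exact absurd (congrArg p (hdisj j j' i i' hi0 hil hi' h.symm)) hne
    · exact .inr (hv j)

/-! ### Upper bounds -/

/-- The interiors of `t` internally disjoint paths of length `l` are disjoint sets of size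
`l - 1`. -/
theorem ConnectedBy.mul_le_card {V K : Type*} [Fintype V] {G : SimpleGraph V}
    {c : G.EdgeLabeling K} {l t : ℕ} {u v : V} (huv : u ≠ v) (h : ConnectedBy c l t u v) :
    t * (l - 1) ≤ Fintype.card V := by
  classical
  obtain ⟨P, rfl, hP, hdisj⟩ := h
  have hcard : ∀ p ∈ P, (p.1.support.toFinset \ {u, v}).card = l - 1 := by
    intro p hp
    rw [Finset.card_sdiff_of_subset, Finset.card_pair huv,
      List.toFinset_card_of_nodup p.2.support_nodup, Walk.length_support, (hP p hp).1]
    · omega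
    · intro w hw
      simp only [Finset.mem_insert, Finset.mem_singleton] at hw
      rcases hw with rfl | rfl <;> simp
  calc P.card * (l - 1) = ∑ p ∈ P, (p.1.support.toFinset \ {u, v}).card := by
        rw [Finset.sum_congr rfl hcard, Finset.sum_const, smul_eq_mul]
    _ = (P.biUnion fun p => p.1.support.toFinset \ {u, v}).card := by
        rw [Finset.card_biUnion]
        intro p hp q hq hpq
        rw [Function.onFun, Finset.disjoint_left]
        intro w hw hw'
        simp only [Finset.mem_sdiff, List.mem_toFinset, Finset.mem_insert,
          Finset.mem_singleton] at hw hw'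
        exact hw.2 (hdisj p hp q hq hpq w hw.1 hw'.1)
    _ ≤ Fintype.card V := Finset.card_le_univ _

/-- The middle vertices of `t` internally disjoint alternating paths of length two. -/
theorem ConnectedBy.le_card_of_two {V K : Type*} [Fintype V] [DecidableEq V] [DecidableEq K]
    {c : (⊤ : SimpleGraph V).EdgeLabeling K} {C : Sym2 V → K}
    (hC : ∀ x y h, c.get x y h = C s(x, y)) {t : ℕ} {u v : V}
    (h : ConnectedBy c 2 t u v) :
    t ≤ (Finset.univ.filter fun w => (u ≠ w ∧ v ≠ w) ∧ C s(u, w) ≠ C s(v, w)).card := by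
  obtain ⟨P, rfl, hP, hdisj⟩ := h
  have key : ∀ p : (⊤ : SimpleGraph V).Path u v, ∃ w, p ∈ P →
      w ∈ p.1.support ∧ (u ≠ w ∧ v ≠ w) ∧ C s(u, w) ≠ C s(v, w) := by
    intro p
    by_cases hpP : p ∈ P
    swap
    -- A dummy value, making the choice of a middle vertex a total function.
    · exact ⟨u, fun h => absurd h hpP⟩
    obtain ⟨p, hp⟩ := p
    obtain ⟨hlen, halt⟩ := hP _ hpP
    cases p with
    | nil => simp at hlen
    | cons h1 p =>
      cases p with
      | nil => simp at hlen
      | cons h2 p =>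
        cases p with
        | cons h3 p => simp at hlen
        | nil =>
          rename_i w
          refine ⟨w, fun _ => ⟨by simp, ⟨h1.ne, h2.ne'⟩, ?_⟩⟩
          simp only [IsAlternating, colors, hC] at halt
          rw [Sym2.eq_swap (a := v)]
          simpa using halt
  choose m hm using key
  refine Finset.card_le_card_of_injOn m ?_ ?_
  · intro p hp
    simpa using (hm p hp).2
  · intro p hp q hq hpq
    by_contra hne
    have h1 := (hm p hp).2
    rcases hdisj p hp q hq hne (m p) (hm p hp).1 (hpq ▸ (hm q hq).1) with h | h
    · exact h1.1.1 h.symm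
    · exact h1.1.2 h.symm

/-- At every vertex, at most the fraction `1 - 1 / r` of the pairs of edges has two colors. -/
theorem card_bichromatic_pairs_le {V : Type*} [Fintype V] [DecidableEq V] {r : ℕ} (hr : 1 ≤ r)
    (S : Finset V) (g : V → Fin r) :
    (((S ×ˢ S).filter fun p => g p.1 ≠ g p.2).card : ℝ) ≤
      (1 - 1 / (r : ℝ)) * (S.card : ℝ) ^ 2 := by
  have hsame : ((S ×ˢ S).filter fun p => g p.1 = g p.2).card =
      ∑ i, (S.filter fun x => g x = i).card ^ 2 := by
    rw [Finset.card_eq_sum_card_fiberwise (f := fun p => g p.1) (t := Finset.univ) (by simp)]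
    refine Finset.sum_congr rfl fun i _ => ?_
    rw [sq, ← Finset.card_product]
    congr 1
    ext ⟨x, y⟩
    simp only [Finset.mem_filter, Finset.mem_product]
    grind
  have hS : S.card = ∑ i, (S.filter fun x => g x = i).card :=
    Finset.card_eq_sum_card_fiberwise (f := g) (t := Finset.univ) (by simp)
  -- Cauchy–Schwarz: the monochromatic ordered pairs, diagonal included, number at least `|S| ^ 2 /
  -- r`.
  have hcs := sq_sum_le_card_mul_sum_sq (s := (Finset.univ : Finset (Fin r)))
    (f := fun i => ((S.filter fun x => g x = i).card : ℝ))
  have hsum := Finset.card_filter_add_card_filter_not (s := S ×ˢ S) (fun p => g p.1 = g p.2)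
  rw [hsame, Finset.card_product] at hsum
  have hsum' := congrArg (Nat.cast : ℕ → ℝ) hsum
  have hS' := congrArg (Nat.cast : ℕ → ℝ) hS
  push_cast at hsum' hS'
  rw [← hS', Finset.card_univ, Fintype.card_fin] at hcs
  have hr0 : (0 : ℝ) < r := by exact_mod_cast hr
  have h3 : (S.card : ℝ) ^ 2 / r ≤ ∑ i, ((S.filter fun x => g x = i).card : ℝ) ^ 2 := by
    rw [div_le_iff₀ hr0]; linarith
  have h4 : (1 - 1 / (r : ℝ)) * (S.card : ℝ) ^ 2 = S.card ^ 2 - S.card ^ 2 / r := by ring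
  rw [h4]
  simp only [ne_eq]
  linarith

/-- Averaging bound for paths of length two. -/
theorem le_of_mem_achievable_two {n r t : ℕ} (hn : 2 ≤ n) (hr : 1 ≤ r)
    (ht : t ∈ achievable r 2 (⊤ : SimpleGraph (Fin n))) : (t : ℝ) ≤ (1 - 1 / (r : ℝ)) * n := by
  obtain ⟨c, hc⟩ := ht
  -- Loops get an arbitrary color.
  let C : Sym2 (Fin n) → Fin r := fun e => if h : e ∈ (⊤ : SimpleGraph (Fin n)).edgeSet then
    c ⟨e, h⟩ else ⟨0, hr⟩
  have hC : ∀ x y h, c.get x y h = C s(x, y) := by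
    intro x y h
    have h' : s(x, y) ∈ (⊤ : SimpleGraph (Fin n)).edgeSet := h
    simp only [C, dif_pos h']
    rfl
  have hpair : ∀ u v : Fin n, (if u ≠ v then (t : ℝ) else 0) ≤
      ∑ w, if (u ≠ w ∧ v ≠ w) ∧ C s(u, w) ≠ C s(v, w) then (1 : ℝ) else 0 := by
    intro u v
    split_ifs with huv
    · have := (hc u v huv).le_card_of_two hC
      rw [Finset.sum_boole]
      exact_mod_cast this
    · exact Finset.sum_nonneg fun w _ => by split_ifs <;> norm_num
  have hcenter : ∀ w : Fin n,
      ∑ u, ∑ v, (if (u ≠ w ∧ v ≠ w) ∧ C s(u, w) ≠ C s(v, w) then (1 : ℝ) else 0) ≤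
        (1 - 1 / (r : ℝ)) * ((n : ℝ) - 1) ^ 2 := by
    intro w
    have h := card_bichromatic_pairs_le hr (Finset.univ.erase w) fun x => C s(x, w)
    rw [Finset.card_erase_of_mem (Finset.mem_univ _), Finset.card_univ, Fintype.card_fin,
      Nat.cast_sub (by omega), Nat.cast_one] at h
    refine le_trans (le_of_eq ?_) h
    rw [← Finset.sum_product', Finset.sum_boole]
    congr 2
    ext ⟨x, y⟩
    simp
  have hleft : ∑ u : Fin n, ∑ v : Fin n, (if u ≠ v then (t : ℝ) else 0) =
      n * ((n - 1) * t) := by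
    have : ∀ u : Fin n, ∑ v : Fin n, (if u ≠ v then (t : ℝ) else 0) = (n - 1) * t := by
      intro u
      rw [← Finset.sum_filter, Finset.filter_ne, Finset.sum_const,
        Finset.card_erase_of_mem (Finset.mem_univ _), Finset.card_univ, Fintype.card_fin,
        nsmul_eq_mul, Nat.cast_sub (by omega), Nat.cast_one]
    simp only [this]
    simp
  -- Double count the triples `(u, v, w)` in which `w` can be the middle of an alternating path from
  -- `u` to `v`; triples with `u = v` never qualify.
  have htotal : (n : ℝ) * ((n - 1) * t) ≤ n * ((1 - 1 / (r : ℝ)) * ((n : ℝ) - 1) ^ 2) := by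
    rw [← hleft]
    calc _ ≤ ∑ u : Fin n, ∑ v : Fin n, ∑ w,
            (if (u ≠ w ∧ v ≠ w) ∧ C s(u, w) ≠ C s(v, w) then (1 : ℝ) else 0) :=
          Finset.sum_le_sum fun u _ => Finset.sum_le_sum fun v _ => hpair u v
      _ = ∑ w, ∑ u : Fin n, ∑ v : Fin n,
            (if (u ≠ w ∧ v ≠ w) ∧ C s(u, w) ≠ C s(v, w) then (1 : ℝ) else 0) := by
          rw [Finset.sum_congr rfl fun u _ => Finset.sum_comm, Finset.sum_comm]
      _ ≤ ∑ w : Fin n, (1 - 1 / (r : ℝ)) * ((n : ℝ) - 1) ^ 2 :=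
          Finset.sum_le_sum fun w _ => hcenter w
      _ = _ := by simp
  have hn' : (2 : ℝ) ≤ n := by exact_mod_cast hn
  have h1 := le_of_mul_le_mul_left htotal (by linarith)
  have h2 : ((n : ℝ) - 1) * t ≤ (n - 1) * ((1 - 1 / (r : ℝ)) * ((n : ℝ) - 1)) := by
    linarith
  have h3 := le_of_mul_le_mul_left h2 (by linarith)
  have hr1 : 0 ≤ 1 - 1 / (r : ℝ) := by
    rw [sub_nonneg, div_le_one (by exact_mod_cast hr)]
    exact_mod_cast hr
  nlinarith

/-! ### Pseudorandomness and greedy extraction -/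

/-- In a balanced `2`-coloring, both colors occur between any two large sets of vertices. -/
theorem exists_edge_of_balanced {V : Type*} [Fintype V] [DecidableEq V] {C : Sym2 V → Fin 2}
    {δ : ℝ} (hδ : 0 ≤ δ)
    (hC : ∀ u v, u ≠ v → ∀ i j, (1 / 4 - δ) * Fintype.card V ≤ (commonNbrs C u v i j).card)
    {X Y : Finset V}
    (hXY : Fintype.card V + 4 * δ * Fintype.card V * X.card < (X.card : ℝ) * Y.card) (a : Fin 2) :
    ∃ x ∈ X, ∃ y ∈ Y, C s(x, y) = a := by
  by_contra hcon
  push Not at hcon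
  set n : ℝ := (Fintype.card V : ℝ) with hn
  -- Second moment: distinct rows of `σ` have inner product at most `4 * δ * n`, which bounds the
  -- sum of squares of the column sums over `X`. If color `a` were missing, each column in `Y` would
  -- have sum `-|X|`, which is too large. `X` and `Y` may overlap here; the layers used later are
  -- disjoint.
  let σ : V → V → ℝ := fun x w => if C s(x, w) = a then 1 else -1
  have hpair : ∀ x ∈ X, ∀ x' ∈ X,
      ∑ w, σ x w * σ x' w ≤ (if x = x' then n else 0) + 4 * δ * n := by
    intro x _ x' _
    split_ifs with h
    · subst h
      have : ∀ w, σ x w * σ x w = 1 := by intro w; simp only [σ]; split_ifs <;> norm_num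
      have hn0 : 0 ≤ 4 * δ * n := by positivity
      simp only [this, Finset.sum_const, Finset.card_univ, nsmul_eq_mul, mul_one]
      linarith
    · have hpt : ∀ w, σ x w * σ x' w ≤ 1 - 2 * (if w ∈ commonNbrs C x x' 0 1 then 1 else 0)
          - 2 * (if w ∈ commonNbrs C x x' 1 0 then 1 else 0) := by
        intro w
        simp only [σ, commonNbrs, Finset.mem_filter, Finset.mem_univ, true_and]
        generalize C s(x, w) = p
        generalize C s(x', w) = q
        by_cases hw : w ≠ x ∧ w ≠ x'
        · simp only [hw.1, hw.2, ne_eq, not_false_eq_true, and_self, true_and]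
          fin_cases p <;> fin_cases q <;> fin_cases a <;> simp <;> norm_num
        · simp only [hw, false_and, if_false]
          split_ifs <;> norm_num
      have h01 := hC x x' h 0 1
      have h10 := hC x x' h 1 0
      calc ∑ w, σ x w * σ x' w ≤ _ := Finset.sum_le_sum fun w _ => hpt w
        _ = n - 2 * (commonNbrs C x x' 0 1).card - 2 * (commonNbrs C x x' 1 0).card := by
          simp [Finset.sum_sub_distrib, hn]
          ring
        _ ≤ _ := by linarith
  have hlow : (Y.card : ℝ) * (X.card : ℝ) ^ 2 ≤ ∑ w, (∑ x ∈ X, σ x w) ^ 2 := by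
    calc (Y.card : ℝ) * (X.card : ℝ) ^ 2 = ∑ w ∈ Y, (∑ x ∈ X, σ x w) ^ 2 := by
          rw [← nsmul_eq_mul, ← Finset.sum_const]
          refine Finset.sum_congr rfl fun w hw => ?_
          have : ∑ x ∈ X, σ x w = ∑ x ∈ X, (-1 : ℝ) :=
            Finset.sum_congr rfl fun x hx => if_neg (hcon x hx w hw)
          rw [this]; simp
      _ ≤ _ := Finset.sum_le_sum_of_subset_of_nonneg (Finset.subset_univ _)
          fun _ _ _ => sq_nonneg _
  have hup : ∑ w, (∑ x ∈ X, σ x w) ^ 2 ≤ X.card * (n + 4 * δ * n * X.card) := by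
    calc ∑ w, (∑ x ∈ X, σ x w) ^ 2 = ∑ w, ∑ x ∈ X, ∑ x' ∈ X, σ x w * σ x' w := by
          simp_rw [sq, Finset.sum_mul_sum]
      _ = ∑ x ∈ X, ∑ x' ∈ X, ∑ w, σ x w * σ x' w := by
          rw [Finset.sum_comm]
          exact Finset.sum_congr rfl fun x _ => Finset.sum_comm
      _ ≤ ∑ x ∈ X, ∑ x' ∈ X, ((if x = x' then n else 0) + 4 * δ * n) :=
          Finset.sum_le_sum fun x hx => Finset.sum_le_sum fun x' hx' => hpair x hx x' hx'
      _ = ∑ x ∈ X, (n + 4 * δ * n * X.card) := by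
          refine Finset.sum_congr rfl fun x hx => ?_
          rw [Finset.sum_add_distrib, Finset.sum_ite_eq, if_pos hx]
          simp [mul_comm]
      _ = _ := by rw [Finset.sum_const, nsmul_eq_mul]
  have hX : (0 : ℝ) < X.card := by
    rcases Nat.eq_zero_or_pos X.card with h | h
    · rw [h] at hXY
      have : 0 ≤ n := by positivity
      simp at hXY
      linarith
    · exact_mod_cast h
  nlinarith [hlow.trans hup]

/-- A sequence of large sets contains a vertex sequence with prescribed colors. -/
theorem exists_sequence_of_large {V K : Type*} [DecidableEq V] {C : Sym2 V → K} {m : ℕ}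
    (hm : ∀ X Y : Finset V, m ≤ X.card → m ≤ Y.card → ∀ a, ∃ x ∈ X, ∃ y ∈ Y, C s(x, y) = a)
    {k : ℕ} (hk : 1 ≤ k) (a : ℕ → K) (X : ℕ → Finset V) (hX : ∀ i < k, 2 * m ≤ (X i).card) :
    ∃ x : ℕ → V, (∀ i < k, x i ∈ X i) ∧ ∀ i, i + 1 < k → C s(x i, x (i + 1)) = a i := by
  classical
  -- At least `m` vertices of each set are reached. Otherwise at least `m` of the `2 * m` vertices
  -- of the next set are unreached, and an edge of the right color from the reached part leads to
  -- one of them.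
  have key : ∀ j < k, m ≤ ((X j).filter fun y => ∃ x : ℕ → V, (∀ i ≤ j, x i ∈ X i) ∧
      (∀ i < j, C s(x i, x (i + 1)) = a i) ∧ x j = y).card := by
    intro j
    induction j with
    | zero =>
      intro hj
      rw [Finset.filter_true_of_mem]
      · have := hX 0 hj; omega
      · intro y hy
        exact ⟨fun _ => y, by simpa using hy, by simp, rfl⟩
    | succ j ih =>
      intro hj
      have hR := ih (by omega)
      set R := (X j).filter fun y => ∃ x : ℕ → V, (∀ i ≤ j, x i ∈ X i) ∧
        (∀ i < j, C s(x i, x (i + 1)) = a i) ∧ x j = y with hRdef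
      by_contra hlt
      have hsplit := Finset.card_filter_add_card_filter_not (s := X (j + 1))
        (fun y => ∃ x : ℕ → V, (∀ i ≤ j + 1, x i ∈ X i) ∧
          (∀ i < j + 1, C s(x i, x (i + 1)) = a i) ∧ x (j + 1) = y)
      have h2 := hX (j + 1) hj
      obtain ⟨z, hz, y, hy, hzy⟩ := hm R _ hR (show m ≤ ((X (j + 1)).filter fun y =>
        ¬ ∃ x : ℕ → V, (∀ i ≤ j + 1, x i ∈ X i) ∧
          (∀ i < j + 1, C s(x i, x (i + 1)) = a i) ∧ x (j + 1) = y).card by omega) (a j)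
      obtain ⟨-, x, hx1, hx2, rfl⟩ := Finset.mem_filter.1 hz
      obtain ⟨hyX, hy⟩ := Finset.mem_filter.1 hy
      refine hy ⟨fun i => if i ≤ j then x i else y, ?_, ?_, by simp⟩
      · intro i hi
        by_cases hij : i ≤ j
        · simpa [hij] using hx1 i hij
        · obtain rfl : i = j + 1 := by omega
          simpa using hyX
      · intro i hi
        rcases Nat.lt_succ_iff_lt_or_eq.1 hi with hij | rfl
        · have h1 : i ≤ j := by omega
          have h2 : i + 1 ≤ j := by omega
          simpa [h1, h2] using hx2 i hij
        · simpa using hzy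
  -- For `m = 0` the hypothesis `hm` would give an element of the empty set.
  have hm0 : m ≠ 0 := by
    rintro rfl
    obtain ⟨x, hx, -⟩ := hm ∅ ∅ (by simp) (by simp) (a 0)
    simp at hx
  have hpos := key (k - 1) (by omega)
  obtain ⟨y, hy⟩ := Finset.card_pos.1 (show 0 < _ from lt_of_lt_of_le (Nat.pos_of_ne_zero hm0) hpos)
  obtain ⟨-, x, hx1, hx2, -⟩ := Finset.mem_filter.1 hy
  exact ⟨x, fun i hi => hx1 i (by omega), fun i hi => hx2 i (by omega)⟩

/-- Greedy extraction of `s` disjoint vertex sequences with prescribed colors. -/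
theorem exists_disjoint_sequences {V K : Type*} [DecidableEq V] {C : Sym2 V → K} {m : ℕ}
    (hm : ∀ X Y : Finset V, m ≤ X.card → m ≤ Y.card → ∀ a, ∃ x ∈ X, ∃ y ∈ Y, C s(x, y) = a)
    {k : ℕ} (hk : 1 ≤ k) (a : ℕ → K) (s : ℕ) (X : ℕ → Finset V)
    (hX : ∀ i < k, s + 2 * m ≤ (X i).card) :
    ∃ x : Fin s → ℕ → V, (∀ j, ∀ i < k, x j i ∈ X i) ∧
      (∀ j i, i + 1 < k → C s(x j i, x j (i + 1)) = a i) ∧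
      ∀ j j', ∀ i < k, x j i = x j' i → j = j' := by
  induction s generalizing X with
  | zero => exact ⟨Fin.elim0, fun j => j.elim0, fun j => j.elim0, fun j => j.elim0⟩
  | succ s ih =>
    obtain ⟨z, hz1, hz2⟩ := exists_sequence_of_large hm hk a X fun i hi => by
      have := hX i hi; omega
    -- Each set loses only one vertex, and the reserve `2 * m` stays intact.
    obtain ⟨x, hx1, hx2, hx3⟩ := ih (fun i => (X i).erase (z i)) fun i hi => by
      have := hX i hi
      have := Finset.pred_card_le_card_erase (s := X i) (a := z i)
      omega
    have hne : ∀ j, ∀ i < k, x j i ≠ z i := fun j i hi => (Finset.mem_erase.1 (hx1 j i hi)).1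
    refine ⟨Fin.cons z x, ?_, ?_, ?_⟩
    · intro j
      refine Fin.cases ?_ (fun j => ?_) j
      · simpa using hz1
      · intro i hi
        simpa using Finset.mem_of_mem_erase (hx1 j i hi)
    · intro j
      refine Fin.cases ?_ (fun j => ?_) j
      · simpa using hz2
      · simpa using hx2 j
    · intro j j'
      refine Fin.cases ?_ (fun j => ?_) j <;> refine Fin.cases ?_ (fun j' => ?_) j'
      · simp
      · intro i hi h
        exact absurd (by simpa using h.symm) (hne j' i hi)
      · intro i hi h
        exact absurd (by simpa using h) (hne j i hi)
      · intro i hi h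
        rw [hx3 j j' i hi (by simpa using h)]

/-- A set of size at least `k * s` contains `k` disjoint sets of size `s`. -/
theorem exists_disjoint_subsets {V : Type*} [DecidableEq V] (k s : ℕ) (S : Finset V)
    (hS : k * s ≤ S.card) :
    ∃ X : ℕ → Finset V, (∀ i < k, X i ⊆ S ∧ (X i).card = s) ∧
      ∀ i < k, ∀ i' < k, i ≠ i' → Disjoint (X i) (X i') := by
  induction k with
  | zero => exact ⟨fun _ => ∅, by simp, by simp⟩
  | succ k ih =>
    rw [add_mul, one_mul] at hS
    obtain ⟨X, hX1, hX2⟩ := ih (by omega)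
    have hU : ((Finset.range k).biUnion X).card ≤ k * s := by
      simpa using Finset.card_biUnion_le_card_mul (Finset.range k) X s
        fun i hi => (hX1 i (Finset.mem_range.1 hi)).2.le
    have hd := Finset.le_card_sdiff ((Finset.range k).biUnion X) S
    obtain ⟨Y, hY, hYc⟩ := Finset.exists_subset_card_eq
      (show s ≤ (S \ (Finset.range k).biUnion X).card by omega)
    have hdisj : ∀ i < k, Disjoint (X i) Y := by
      intro i hi
      rw [Finset.disjoint_left]
      intro w hw hwY
      exact (Finset.mem_sdiff.1 (hY hwY)).2
        (Finset.mem_biUnion.2 ⟨i, Finset.mem_range.2 hi, hw⟩)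
    refine ⟨fun i => if i < k then X i else Y, ?_, ?_⟩
    · intro i hi
      by_cases hik : i < k
      · simpa [hik] using hX1 i hik
      · simpa [hik] using ⟨hY.trans Finset.sdiff_subset, hYc⟩
    · intro i hi i' hi' hne
      by_cases hik : i < k <;> by_cases hik' : i' < k <;> simp only [hik, hik', if_true, if_false]
      · exact hX2 i hik i' hik' hne
      · exact hdisj i hik
      · exact (hdisj i' hik').symm
      · omega

/-! ### Alternating paths of length at least three -/

/-- The color of the `i`-th edge of an alternating sequence of two colors starting with `a`. -/
def alternate (a : Fin 2) (i : ℕ) : Fin 2 := if Even i then a else a + 1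

theorem alternate_ne_succ (a : Fin 2) (i : ℕ) : alternate a i ≠ alternate a (i + 1) := by
  by_cases h : Even i <;> simp only [alternate, Nat.even_add_one, h] <;> revert a <;> decide

/-- Two vertices with large joint color classes are connected by many alternating paths. -/
theorem connectedBy_of_large_commonNbrs {V K : Type*} [Fintype V] [DecidableEq V]
    {C : Sym2 V → Fin 2} {e : Fin 2 → K} (he : e.Injective) {m : ℕ}
    (hm : ∀ X Y : Finset V, m ≤ X.card → m ≤ Y.card → ∀ a, ∃ x ∈ X, ∃ y ∈ Y, C s(x, y) = a)
    {k s q : ℕ} (hk : 2 ≤ k) (hs : k * (s + 2 * m) ≤ 2 * q) {u v : V} (huv : u ≠ v)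
    (hq : ∀ i j, q ≤ (commonNbrs C u v i j).card) :
    ConnectedBy (labelingOfSym2 ⊤ (e ∘ C)) (k + 1) (2 * s) u v := by
  -- Here `a` is the color of the first edge. All interior vertices lie in the `a`-neighborhood of
  -- `u`, so paths for different `a` are automatically disjoint.
  have key : ∀ a : Fin 2, ∃ x : Fin s → ℕ → V,
      (∀ j, ∀ i < k, (x j i ≠ u ∧ x j i ≠ v) ∧ C s(u, x j i) = a) ∧
      (∀ j, C s(x j (k - 1), v) = alternate a k) ∧
      (∀ j i, i + 1 < k → C s(x j i, x j (i + 1)) = alternate a (i + 1)) ∧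
      ∀ j j', ∀ i < k, ∀ i' < k, x j i = x j' i' → j = j' ∧ i = i' := by
    intro a
    -- The last layer must fit into a single joint class, which is half of what is known about the
    -- `a`-neighborhood; this needs `2 ≤ k`.
    have hs' : s + 2 * m ≤ q := by nlinarith
    obtain ⟨Y, hY, hYc⟩ := Finset.exists_subset_card_eq (hs'.trans (hq a (alternate a k)))
    have hdisj01 : Disjoint (commonNbrs C u v a 0) (commonNbrs C u v a 1) := by
      rw [Finset.disjoint_left]
      intro w hw hw'
      simp only [commonNbrs, Finset.mem_filter] at hw hw'
      simp [hw.2.2.2] at hw'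
    have hcard : 2 * q ≤ (commonNbrs C u v a 0 ∪ commonNbrs C u v a 1).card := by
      rw [Finset.card_union_of_disjoint hdisj01]
      have := hq a 0
      have := hq a 1
      omega
    have hd := Finset.le_card_sdiff Y (commonNbrs C u v a 0 ∪ commonNbrs C u v a 1)
    obtain ⟨X, hX1, hX2⟩ := exists_disjoint_subsets (k - 1) (s + 2 * m)
      ((commonNbrs C u v a 0 ∪ commonNbrs C u v a 1) \ Y) (by
        rw [Nat.sub_mul, one_mul]; omega)
    have hXY : ∀ i < k - 1, Disjoint (X i) Y := fun i hi =>
      Finset.disjoint_of_subset_left (hX1 i hi).1 Finset.sdiff_disjoint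
    let Z : ℕ → Finset V := fun i => if i < k - 1 then X i else Y
    obtain ⟨x, hx1, hx2, hx3⟩ := exists_disjoint_sequences hm (by omega : 1 ≤ k)
      -- The shift by one accounts for the initial edge from `u`.
      (fun i => alternate a (i + 1)) s Z (by
        intro i hi
        by_cases h : i < k - 1
        · simp [Z, h, (hX1 i h).2]
        · simp [Z, h, hYc])
    have hZ : ∀ i < k, ∀ w ∈ Z i, (w ≠ u ∧ w ≠ v) ∧ C s(u, w) = a := by
      intro i hi w hw
      by_cases h : i < k - 1
      · simp only [Z, h, if_true] at hw
        have := (hX1 i h).1 hw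
        simp only [commonNbrs, Finset.mem_sdiff, Finset.mem_union, Finset.mem_filter] at this
        tauto
      · simp only [Z, h, if_false] at hw
        have := hY hw
        simp only [commonNbrs, Finset.mem_filter] at this
        tauto
    have hZd : ∀ i < k, ∀ i' < k, i ≠ i' → Disjoint (Z i) (Z i') := by
      intro i hi i' hi' hne
      by_cases h : i < k - 1 <;> by_cases h' : i' < k - 1 <;> simp only [Z, h, h', if_true, if_false]
      · exact hX2 i h i' h' hne
      · exact hXY i h
      · exact (hXY i' h').symm
      · omega
    refine ⟨x, fun j i hi => hZ i hi _ (hx1 j i hi), ?_, hx2, ?_⟩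
    · intro j
      have h := hx1 j (k - 1) (by omega)
      simp only [Z, lt_irrefl, if_false] at h
      have := hY h
      simp only [commonNbrs, Finset.mem_filter] at this
      rw [Sym2.eq_swap]
      exact this.2.2.2
    · intro j j' i hi i' hi' h
      have hii : i = i' := by
        by_contra hne
        exact Finset.disjoint_left.1 (hZd i hi i' hi' hne) (hx1 j i hi) (h ▸ hx1 j' i' hi')
      subst hii
      exact ⟨hx3 j j' i hi h, rfl⟩
  choose x hx1 hx2 hx3 hx4 using key
  let f : Fin 2 × Fin s → ℕ → V := fun p i =>
    if i = 0 then u else if i ≤ k then x p.1 p.2 (i - 1) else v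
  have hf0 : ∀ p, f p 0 = u := fun p => by simp [f]
  have hfk : ∀ p, f p (k + 1) = v := fun p => by simp [f]
  have hfi : ∀ p, ∀ i < k, f p (i + 1) = x p.1 p.2 i := fun p i hi => by
    simp [f, Nat.succ_le_of_lt hi]
  have hx5 : ∀ p p' : Fin 2 × Fin s, ∀ i < k, ∀ i' < k, x p.1 p.2 i = x p'.1 p'.2 i' →
      p = p' ∧ i = i' := by
    rintro ⟨a, j⟩ ⟨a', j'⟩ i hi i' hi' h
    simp only at h
    obtain rfl : a = a' := by
      rw [← (hx1 a j i hi).2, h, (hx1 a' j' i' hi').2]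
    obtain ⟨rfl, rfl⟩ := hx4 a j j' i hi i' hi' h
    exact ⟨rfl, rfl⟩
  have hfint : ∀ p p' i i', 0 < i → i < k + 1 → i' ≤ k + 1 → f p i = f p' i' →
      p = p' ∧ i = i' := by
    intro p p' i i' hi0 hik hi' h
    obtain ⟨i, rfl⟩ := Nat.exists_eq_succ_of_ne_zero hi0.ne'
    rw [Nat.succ_eq_add_one, hfi p i (by omega)] at h
    have hne := (hx1 p.1 p.2 i (by omega)).1
    rcases Nat.eq_zero_or_pos i' with rfl | hi'0
    · exact absurd (h.trans (hf0 p')) hne.1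
    rcases hi'.lt_or_eq with hlt | rfl
    · obtain ⟨i', rfl⟩ := Nat.exists_eq_succ_of_ne_zero hi'0.ne'
      rw [Nat.succ_eq_add_one, hfi p' i' (by omega)] at h
      obtain ⟨h1, h2⟩ := hx5 p p' i (by omega) i' (by omega) h
      exact ⟨h1, by rw [h2]⟩
    · exact absurd (h.trans (hfk p')) hne.2
  have hcol : ∀ p, ∀ i ≤ k, C s(f p i, f p (i + 1)) = alternate p.1 i := by
    intro p i hi
    rcases Nat.eq_zero_or_pos i with rfl | hi0
    · rw [hf0, hfi p 0 (by omega), (hx1 p.1 p.2 0 (by omega)).2]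
      simp [alternate]
    obtain ⟨i, rfl⟩ := Nat.exists_eq_succ_of_ne_zero hi0.ne'
    rw [Nat.succ_eq_add_one] at hi ⊢
    rw [hfi p i (by omega)]
    rcases hi.lt_or_eq with hlt | rfl
    · rw [hfi p (i + 1) hlt, hx3 p.1 p.2 i hlt]
    · rw [hfk]
      simpa using hx2 p.1 p.2
  have hmain := connectedBy_of_sequences (C := e ∘ C) (l := k + 1) (by omega) f hf0 hfk
    (by
      intro p i hi i' hi' h
      simp only [Set.mem_Iic] at hi hi'
      rcases Nat.eq_zero_or_pos i with rfl | hi0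
      · rcases Nat.eq_zero_or_pos i' with rfl | hi'0
        · rfl
        rcases hi'.lt_or_eq with hlt | rfl
        · exact (hfint p p i' 0 hi'0 hlt (by omega) h.symm).2.symm
        · rw [hf0, hfk] at h; exact absurd h huv
      rcases hi.lt_or_eq with hlt | rfl
      · exact (hfint p p i i' hi0 hlt hi' h).2
      rcases Nat.eq_zero_or_pos i' with rfl | hi'0
      · rw [hf0, hfk] at h; exact absurd h.symm huv
      rcases hi'.lt_or_eq with hlt | rfl
      · exact (hfint p p i' _ hi'0 hlt (by omega) h.symm).2.symm
      · rfl)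
    (fun p p' i i' hi0 hil hi' h => (hfint p p' i i' hi0 hil hi' h).1)
    (by
      intro p i hi h
      have h' := he h
      rw [hcol p i (by omega), hcol p (i + 1) (by omega)] at h'
      exact alternate_ne_succ _ _ h')
  simpa using hmain

/-! ### Asymptotic lower bounds and conclusion -/

theorem isEquivalent_const_mul_of_bounds {f : ℕ → ℝ} {a : ℝ} (ha : 0 < a)
    (hup : ∀ᶠ n : ℕ in Filter.atTop, f n ≤ a * n)
    (hlow : ∀ ε > 0, ∀ᶠ n : ℕ in Filter.atTop, (a - ε) * n ≤ f n) :
    Asymptotics.IsEquivalent Filter.atTop f fun n : ℕ => a * (n : ℝ) := by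
  rw [Asymptotics.IsEquivalent, Asymptotics.isLittleO_iff]
  intro c hc
  filter_upwards [hup, hlow (c * a) (by positivity)] with n h1 h2
  rw [Pi.sub_apply, Real.norm_eq_abs, Real.norm_eq_abs, abs_of_nonpos (by linarith),
    abs_of_nonneg (by positivity)]
  linarith

theorem le_alternatingConnectivity_top {n r l t : ℕ} (hn : 2 ≤ n) (hr : 1 ≤ r)
    (ht : t ∈ achievable r l (⊤ : SimpleGraph (Fin n))) :
    t ≤ alternatingConnectivity r l (⊤ : SimpleGraph (Fin n)) :=
  haveI : Nontrivial (Fin n) := Fin.nontrivial_iff_two_le.2 hn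
  (isGreatest_alternatingConnectivity hr l _).2 ht

theorem alternatingConnectivity_mem_top {n r : ℕ} (hn : 2 ≤ n) (hr : 1 ≤ r) (l : ℕ) :
    alternatingConnectivity r l (⊤ : SimpleGraph (Fin n)) ∈
      achievable r l (⊤ : SimpleGraph (Fin n)) :=
  haveI : Nontrivial (Fin n) := Fin.nontrivial_iff_two_le.2 hn
  (isGreatest_alternatingConnectivity hr l _).1

theorem connectedBy_two_of_le_card {V K : Type*} [Fintype V] [DecidableEq V] [DecidableEq K]
    {C : Sym2 V → K} {u v : V} (huv : u ≠ v) {t : ℕ}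
    (ht : t ≤ (Finset.univ.filter fun w => (w ≠ u ∧ w ≠ v) ∧ C s(u, w) ≠ C s(v, w)).card) :
    ConnectedBy (labelingOfSym2 ⊤ C) 2 t u v := by
  obtain ⟨Y, hY, rfl⟩ := Finset.exists_subset_card_eq ht
  have hY' : ∀ w : Y, (w.1 ≠ u ∧ w.1 ≠ v) ∧ C s(u, w.1) ≠ C s(v, w.1) := fun w => by
    simpa using hY w.2
  let f : Y → ℕ → V := fun w i => if i = 0 then u else if i = 1 then w else v
  have h := connectedBy_of_sequences (C := C) (l := 2) le_rfl (u := u) (v := v) f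
    (fun w => by simp [f]) (fun w => by simp [f])
    (by
      intro w i hi i' hi' h
      simp only [Set.mem_Iic] at hi hi'
      have := hY' w
      interval_cases i <;> interval_cases i' <;> simp [f] at h ⊢ <;> grind)
    (by
      intro w w' i i' hi0 hi hi' h
      have := hY' w
      obtain rfl : i = 1 := by omega
      interval_cases i' <;> simp [f] at h <;> grind)
    (by
      intro w i hi
      obtain rfl : i = 0 := by omega
      have := (hY' w).2
      rw [Sym2.eq_swap (a := v)] at this
      simpa [f] using this)
  simpa using h

/-- Most pairs of colors are bichromatic, so balanced colorings have many bichromatic cherries. -/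
theorem le_card_bichromatic_of_balanced {V : Type*} [Fintype V] [DecidableEq V] {r : ℕ}
    {C : Sym2 V → Fin r} {u v : V} {b : ℝ} (hb : ∀ i j, b ≤ (commonNbrs C u v i j).card) :
    ((r : ℝ) ^ 2 - r) * b ≤
      (Finset.univ.filter fun w => (w ≠ u ∧ w ≠ v) ∧ C s(u, w) ≠ C s(v, w)).card := by
  have hsub : (Finset.univ : Finset (Fin r)).offDiag.biUnion
      (fun p => commonNbrs C u v p.1 p.2) ⊆
      Finset.univ.filter fun w => (w ≠ u ∧ w ≠ v) ∧ C s(u, w) ≠ C s(v, w) := by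
    intro w hw
    obtain ⟨⟨i, j⟩, hij, hw⟩ := Finset.mem_biUnion.1 hw
    simp only [commonNbrs, Finset.mem_filter, Finset.mem_univ, true_and, Finset.mem_offDiag]
      at hij hw ⊢
    exact ⟨hw.1, by rw [hw.2.1, hw.2.2]; exact hij⟩
  have hdisj : ((Finset.univ : Finset (Fin r)).offDiag : Set (Fin r × Fin r)).PairwiseDisjoint
      fun p => commonNbrs C u v p.1 p.2 := by
    intro p _ q _ hpq
    rw [Function.onFun, Finset.disjoint_left]
    intro w hw hw'
    simp only [commonNbrs, Finset.mem_filter] at hw hw'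
    exact hpq (Prod.ext (hw.2.2.1.symm.trans hw'.2.2.1) (hw.2.2.2.symm.trans hw'.2.2.2))
  have hcard := Finset.card_le_card hsub
  rw [Finset.card_biUnion hdisj] at hcard
  have hoff : (((Finset.univ : Finset (Fin r)).offDiag.card : ℕ) : ℝ) = (r : ℝ) ^ 2 - r := by
    rw [Finset.offDiag_card, Finset.card_univ, Fintype.card_fin, Nat.cast_sub (Nat.le_mul_self r)]
    push_cast
    ring
  calc ((r : ℝ) ^ 2 - r) * b
      = ∑ p ∈ (Finset.univ : Finset (Fin r)).offDiag, b := by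
        rw [Finset.sum_const, nsmul_eq_mul, hoff]
    _ ≤ ∑ p ∈ (Finset.univ : Finset (Fin r)).offDiag,
          ((commonNbrs C u v p.1 p.2).card : ℝ) := Finset.sum_le_sum fun p _ => hb _ _
    _ ≤ _ := by exact_mod_cast hcard

theorem eventually_le_alternatingConnectivity_two {r : ℕ} (hr : 2 ≤ r) {ε : ℝ} (hε : 0 < ε) :
    ∀ᶠ n : ℕ in Filter.atTop, (1 - 1 / (r : ℝ) - ε) * n ≤
      (alternatingConnectivity r 2 (⊤ : SimpleGraph (Fin n)) : ℝ) := by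
  have hr0 : (0 : ℝ) < r := by positivity
  -- With this error the count is `(1 - 1 / r) * (1 - ε) * n`.
  filter_upwards [eventually_exists_balanced_coloring r (by omega)
    (show 0 < ε / (r : ℝ) ^ 2 by positivity), Filter.eventually_ge_atTop 2] with n ⟨C, hC⟩ hn
  have hmem : ⌈(1 - 1 / (r : ℝ) - ε) * n⌉₊ ∈ achievable r 2 (⊤ : SimpleGraph (Fin n)) := by
    refine ⟨labelingOfSym2 ⊤ C, fun u v huv => connectedBy_two_of_le_card huv ?_⟩
    rw [Nat.ceil_le]
    refine le_trans ?_ (le_card_bichromatic_of_balanced (hC u v huv))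
    have h1 : ((r : ℝ) ^ 2 - r) * ((1 / (r : ℝ) ^ 2 - ε / (r : ℝ) ^ 2) * n) =
        (1 - 1 / (r : ℝ) - ε) * n + ε / r * n := by
      field_simp
      ring
    have h2 : 0 ≤ ε / r * n := by positivity
    linarith
  exact (Nat.le_ceil _).trans
    (by exact_mod_cast le_alternatingConnectivity_top hn (by omega) hmem)

/-- Here `k` counts the interior vertices. A balanced coloring with two of the `r` colors already
attains the bound. -/
theorem eventually_le_alternatingConnectivity {r k : ℕ} (hr : 2 ≤ r) (hk : 2 ≤ k) {ε : ℝ}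
    (hε : 0 < ε) :
    ∀ᶠ n : ℕ in Filter.atTop, (1 / (k : ℝ) - ε) * n ≤
      (alternatingConnectivity r (k + 1) (⊤ : SimpleGraph (Fin n)) : ℝ) := by
  -- The losses are `η * n / 2` from balance, `4 * η * n` from the reserves, and rounding of at most
  -- `6 ≤ η * n`.
  set η : ℝ := ε / 6 with hη
  have hη0 : 0 < η := by positivity
  have hlarge1 : ∀ᶠ n : ℕ in Filter.atTop, 2 / η ^ 2 + 1 ≤ (n : ℝ) :=
    tendsto_natCast_atTop_atTop.eventually_ge_atTop _
  have hlarge2 : ∀ᶠ n : ℕ in Filter.atTop, 6 / η ≤ (n : ℝ) :=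
    tendsto_natCast_atTop_atTop.eventually_ge_atTop _
  filter_upwards [eventually_exists_balanced_coloring 2 (by norm_num)
    (show 0 < η / 8 by positivity), Filter.eventually_ge_atTop 2, hlarge1, hlarge2]
    with n ⟨C, hC⟩ hn hn1 hn2
  have hn0 : (0 : ℝ) < n := by positivity
  have hbal : ∀ u v, u ≠ v → ∀ i j,
      (1 / 4 - η / 8) * Fintype.card (Fin n) ≤ (commonNbrs C u v i j).card := by
    intro u v huv i j
    have := hC u v huv i j
    norm_num at this ⊢
    exact this
  set m := ⌈η * n⌉₊ with hm
  set q := ⌈(1 / 4 - η / 8) * (n : ℝ)⌉₊ with hq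
  have hdense : ∀ X Y : Finset (Fin n), m ≤ X.card → m ≤ Y.card → ∀ a,
      ∃ x ∈ X, ∃ y ∈ Y, C s(x, y) = a := by
    intro X Y hX hY a
    refine exists_edge_of_balanced (by positivity) hbal ?_ a
    rw [Fintype.card_fin]
    have hX' : η * n ≤ X.card := (Nat.le_ceil _).trans (by exact_mod_cast hX)
    have hY' : η * n ≤ Y.card := (Nat.le_ceil _).trans (by exact_mod_cast hY)
    -- Half of `|X| * |Y|` absorbs the term `η * n * |X| / 2`; the other half exceeds `n` because `η
    -- ^ 2 * n > 2`.
    have h1 : η * n * (η * n) ≤ (X.card : ℝ) * Y.card := by gcongr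
    have h2 : η * n * X.card ≤ (X.card : ℝ) * Y.card := by
      rw [mul_comm (X.card : ℝ)]; gcongr
    have h3 : 2 < η ^ 2 * n := by
      have : 2 / η ^ 2 < n := by linarith
      rwa [div_lt_iff₀' (by positivity)] at this
    nlinarith
  have hD := Nat.div_add_mod (2 * q) k
  have hD' := Nat.mod_lt (2 * q) (show k > 0 by omega)
  -- The layer size; removing the reserve leaves `s = D - 2 * m` paths for each first color.
  set D := 2 * q / k with hDdef
  have hk0 : (2 : ℝ) ≤ k := by exact_mod_cast hk
  have hDr : 2 * (q : ℝ) ≤ k * (D + 1) := by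
    have : 2 * q ≤ k * (D + 1) := by rw [mul_add, mul_one]; omega
    exact_mod_cast this
  have hqr : (1 / 4 - η / 8) * (n : ℝ) ≤ q := Nat.le_ceil _
  have hmr : (m : ℝ) ≤ η * n + 1 := (Nat.ceil_lt_add_one (by positivity)).le
  have hreal : (1 / (k : ℝ) - ε) * n ≤ 2 * D - 4 * m := by
    have h1 : 2 * (q : ℝ) / k ≤ D + 1 := by
      rw [div_le_iff₀' (by linarith)]; exact hDr
    have h2 : 2 * ((1 / 4 - η / 8) * (n : ℝ)) / k ≤ 2 * (q : ℝ) / k := by gcongr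
    have h3 : 2 * ((1 / 4 - η / 8) * (n : ℝ)) / k = (1 / k) * n / 2 - (η * n / 4) * (1 / k) := by
      field_simp
      ring
    have h4 : (1 : ℝ) / k ≤ 1 := by
      rw [div_le_one (by linarith)]; linarith
    have h5 : (η * n / 4) * (1 / k) ≤ η * n / 4 := mul_le_of_le_one_right (by positivity) h4
    have h6 : 6 ≤ η * n := by
      rwa [div_le_iff₀' hη0] at hn2
    have h7 : ε = 6 * η := by rw [hη]; ring
    rw [h7]
    linarith
  by_cases hDm : 2 * m ≤ D
  · have hmem : 2 * (D - 2 * m) ∈ achievable r (k + 1) (⊤ : SimpleGraph (Fin n)) := by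
      refine ⟨labelingOfSym2 ⊤ (Fin.castLE hr ∘ C), fun u v huv =>
        connectedBy_of_large_commonNbrs (Fin.castLE_injective hr) hdense hk (q := q) ?_ huv ?_⟩
      · rw [Nat.sub_add_cancel hDm]; omega
      · intro i j
        rw [hq, Nat.ceil_le]
        simpa using hbal u v huv i j
    have hle := le_alternatingConnectivity_top hn (by omega) hmem
    have hle' : ((2 * (D - 2 * m) : ℕ) : ℝ) ≤
        (alternatingConnectivity r (k + 1) (⊤ : SimpleGraph (Fin n)) : ℝ) := by
      exact_mod_cast hle
    rw [Nat.cast_mul, Nat.cast_sub hDm] at hle'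
    push_cast at hle'
    linarith
  -- Here the claimed lower bound is not positive.
  · have : (D : ℝ) ≤ 2 * m := by
      have : D ≤ 2 * m := by omega
      exact_mod_cast this
    have h0 : (0 : ℝ) ≤ (alternatingConnectivity r (k + 1) (⊤ : SimpleGraph (Fin n)) : ℝ) := by
      positivity
    linarith

end AltConn

theorem theorem5p1 (r : ℕ) (hr : 2 ≤ r) :
    Asymptotics.IsEquivalent Filter.atTop
      (fun n : ℕ => (AltConn.alternatingConnectivity r 2 (⊤ : SimpleGraph (Fin n)) : ℝ))
      (fun n : ℕ => (1 - 1 / (r : ℝ)) * (n : ℝ)) ∧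
    ∀ l : ℕ, 3 ≤ l →
      Asymptotics.IsEquivalent Filter.atTop
        (fun n : ℕ => (AltConn.alternatingConnectivity r l (⊤ : SimpleGraph (Fin n)) : ℝ))
        (fun n : ℕ => (n : ℝ) / ((l : ℝ) - 1)) := by
  have hr' : (2 : ℝ) ≤ r := by exact_mod_cast hr
  refine ⟨AltConn.isEquivalent_const_mul_of_bounds ?_ ?_ ?_, fun l hl => ?_⟩
  · rw [sub_pos, div_lt_one (by linarith)]
    linarith
  · filter_upwards [Filter.eventually_ge_atTop 2] with n hn
    exact AltConn.le_of_mem_achievable_two hn (by omega)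
      (AltConn.alternatingConnectivity_mem_top hn (by omega) 2)
  · exact fun ε hε => AltConn.eventually_le_alternatingConnectivity_two hr hε
  · obtain ⟨k, rfl⟩ : ∃ k, l = k + 1 := ⟨l - 1, by omega⟩
    have hk : (0 : ℝ) < k := by
      have : 0 < k := by omega
      exact_mod_cast this
    have hfun : (fun n : ℕ => (n : ℝ) / (((k + 1 : ℕ) : ℝ) - 1)) =
        fun n : ℕ => 1 / (k : ℝ) * (n : ℝ) := by
      funext n
      push_cast
      rw [add_sub_cancel_right]
      ring
    rw [hfun]
    refine AltConn.isEquivalent_const_mul_of_bounds (by positivity) ?_ fun ε hε =>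
      AltConn.eventually_le_alternatingConnectivity hr (by omega) hε
    filter_upwards [Filter.eventually_ge_atTop 2] with n hn
    obtain ⟨c, hc⟩ := AltConn.alternatingConnectivity_mem_top hn (by omega : 1 ≤ r) (k + 1)
    -- A single pair of vertices gives the upper bound.
    have h := (hc ⟨0, by omega⟩ ⟨1, by omega⟩ (by simp)).mul_le_card (by simp)
    rw [Fintype.card_fin, Nat.add_sub_cancel] at h
    rw [div_mul_eq_mul_div, one_mul, le_div_iff₀ hk]
    exact_mod_cast h
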